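/- Let $z = x + iy \in \mathbb{C}$ with $y = \operatorname{Im} z > 0$, and for $\omega = mz+n$ and $\omega' = m'z+n'$ in the lattice $\mathbb{Z}z+\mathbb{Z}$ (with $m,n,m',n'\in\mathbb{Z}$) let $\det(\omega\ \omega') = mn'-m'n$, the determinant of their integer coordinates with respect to the basis $z, 1$. Then for every $s\in\mathbb{C}$ with $\operatorname{Re} s > -1$, $$\sum_{\substack{\omega_1,\omega_2,\omega_3\in\mathbb{Z}z+\mathbb{Z}\\ \omega_1+\omega_2+\omega_3=0}}{}^{\!\!\!\!\!\!\!\prime}\ \ \frac{|\det(\omega_1\ \omega_2)|^{-s}}{|\omega_1\omega_2\omega_3|^2} = \frac{6\pi}{y^3}\,\zeta(s+3)\,\zeta(s+2),$$ where the sum runs over all ordered triples with $\omega_1,\omega_2,\omega_3 \neq 0$ and $\det(\omega_1\ \omega_2)\neq 0$ (that is, without the collinear triples), and converges absolutely. -/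

import Mathlib

/-- The point `m z + n` of the lattice `ℤ z + ℤ ⊆ ℂ` with integer coordinates `v = (m, n)`.
If `z` is not real, every point of the lattice has exactly one such pair of coordinates. -/
def latticePoint (z : ℂ) (v : Fin 2 → ℤ) : ℂ := (v 0 : ℂ) * z + (v 1 : ℂ)

/-- The determinant of two lattice points, the columns being their integer coordinates with
respect to the basis `z, 1`. Its absolute value is the index in `ℤ z + ℤ` of the sublattice
that the two points span (and is zero if they are collinear). -/
def latticeDet (v w : Fin 2 → ℤ) : ℤ := Matrix.det !![v 0, w 0; v 1, w 1]

/-- Ordered triples `(ω₁, ω₂, ω₃)` of points of `ℤ z + ℤ`, given by their coordinates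
`v 0, v 1, v 2`, with `ω₁ + ω₂ + ω₃ = 0`, all `ωₖ ≠ 0`, and `det(ω₁ ω₂) ≠ 0`. -/
def AdmissibleTriple (z : ℂ) : Type :=
  {v : Fin 3 → Fin 2 → ℤ //
    latticePoint z (v 0) + latticePoint z (v 1) + latticePoint z (v 2) = 0 ∧
    (∀ k, latticePoint z (v k) ≠ 0) ∧
    latticeDet (v 0) (v 1) ≠ 0}

/-- The summand `|det(ω₁ ω₂)| ^ (-s) / |ω₁ ω₂ ω₃| ^ 2`. -/
noncomputable def tripleTerm (z s : ℂ) (t : AdmissibleTriple z) : ℂ :=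
  ((|latticeDet (t.1 0) (t.1 1)| : ℤ) : ℂ) ^ (-s) /
    ((‖latticePoint z (t.1 0) * latticePoint z (t.1 1) * latticePoint z (t.1 2)‖ : ℝ) : ℂ) ^ 2

/-!
Grouped by the determinant `D`, the claim reduces to one identity: over the pairs `(u, v)` with
`det (u v) = n > 0`, the sum of `1 / |u v (u + v)| ^ 2` is `3 π σ₁(n) / (n y) ^ 3`. Exchanging `u`
and `v` gives the same value for `-n`, and `∑ σ₁(n) n ^ (-s - 3) = ζ(s + 3) ζ(s + 2)`.

For the identity, map a lattice point `u` to the point `(u / |u|) ^ 2` of the unit circle. The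
points belonging to `u`, `v`, `u + v` span a triangle of area `2 (n y) ^ 3 / |u v (u + v)| ^ 2`,
which is the circular segment of the chord `(u, v)` minus those of `(u, u + v)` and `(u + v, v)`.
The area of a segment depends only on the cotangent `t` of the angle between `u` and `v`, as
`π / 2 - h(t)` with `h = segmentFun` (`two_div_eq_segmentFun`, `DetPair.triangleTerm_eq`).
Since `(u, v) ↦ (u, u + v)` and `(u, v) ↦ (u + v, v)` permute the pairs of determinant `n`, the sum
would be computed by the sum of `h(t)`, which however diverges: `h` tends to `± π / 2` at `± ∞`.
So `h(t)` is replaced by `h(t) - (π / 2) ε`, where `ε = DetPair.cuspSign` is the sign of `t` in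
the limit `z → i ∞`. It agrees with the sign of `t` as long as `|t|` is large
(`DetPair.exists_cotAngle_bounds`), so the difference is `O((1 + t ^ 2) ^ (-3 / 2))`, that is
`O(|u| ^ (-3) |v| ^ (-3))`, and is absolutely summable; by the symmetry `(u, v) ↦ (-v, u)`, which
changes the signs of `t` and of `ε`, its sum is zero (`DetPair.hasSum_segmentTerm`).

What remains is `π / 2` times the sum of `ε(u, u + v) + ε(u + v, v) - ε(u, v) - 1`, a purely
combinatorial quantity independent of `z`. It vanishes unless one of `u`, `v`, `u + v` has first
coordinate zero (`lexSign_defect`), and the three cases, permuted by a rotation of the triple,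
contribute `4 σ₁(n)` each (`DetPair.hasSum_axisTerm`).
-/

/-! ### The segment function -/

/-- A chord of the unit circle whose inscribed angle has cotangent `t` cuts off a circular
segment of area `π / 2 - segmentFun t`. The function is odd, with limits `± π / 2` at `± ∞`. -/
noncomputable def segmentFun (t : ℝ) : ℝ := Real.arctan t + t / (1 + t ^ 2)

lemma segmentFun_neg (t : ℝ) : segmentFun (-t) = -segmentFun t := by
  simp only [segmentFun, Real.arctan_neg]
  ring

/-- The addition theorem `cot (α + β) = (cot α cot β - 1) / (cot α + cot β)`, for angles
`α, β > 0` with `α + β < π`. -/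
lemma arctan_add_arctan_eq_pi_div_two_add {x y t : ℝ} (hxy : 0 < x + y)
    (h : t * (x + y) = x * y - 1) :
    Real.arctan x + Real.arctan y = Real.pi / 2 + Real.arctan t := by
  rcases lt_trichotomy (x * y) 1 with h1 | h1 | h1
  · have ht : t < 0 := by
      by_contra! ht
      nlinarith [mul_nonneg ht hxy.le]
    rw [Real.arctan_add h1]
    have : (x + y) / (1 - x * y) = (-t)⁻¹ := by
      rw [div_eq_iff (by linarith), inv_mul_eq_div, eq_div_iff (by linarith)]
      linarith
    rw [this, Real.arctan_inv_of_pos (by linarith), Real.arctan_neg]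
    ring
  · have ht : t = 0 := by
      have : t * (x + y) = 0 := by linarith
      rcases mul_eq_zero.1 this with h | h
      · exact h
      · linarith
    have hx : 0 < x := by
      by_contra! hx
      nlinarith
    have hy : y = x⁻¹ := eq_inv_of_mul_eq_one_right h1
    rw [hy, Real.arctan_inv_of_pos hx, ht, Real.arctan_zero]
    ring
  · have ht : 0 < t := by
      by_contra! ht
      nlinarith [mul_nonneg (neg_nonneg.2 ht) hxy.le]
    have hx : 0 < x := by
      by_contra! hx
      nlinarith
    rw [Real.arctan_add_eq_add_pi h1 hx]
    have : (x + y) / (1 - x * y) = -t⁻¹ := by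
      rw [div_eq_iff (by linarith), show -t⁻¹ * (1 - x * y) = (x * y - 1) / t by ring,
        eq_div_iff ht.ne']
      linarith
    rw [this, Real.arctan_neg, Real.arctan_inv_of_pos ht]
    ring

/-- The area of the triangle inscribed in the unit circle whose angles have cotangents `t + A`,
`t + B` and `-t`: the disc without the three circular segments cut off by the sides. -/
lemma two_div_eq_segmentFun {t A B : ℝ} (hA : 0 < A) (hB : 0 < B) (h : A * B = t ^ 2 + 1) :
    2 / (A * B * (A + B + 2 * t)) =
      segmentFun (t + A) + segmentFun (t + B) - segmentFun t - Real.pi / 2 := by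
  have hC : 0 < A + B + 2 * t := by
    by_contra! hC
    nlinarith [sq_nonneg (A - B)]
  have harc : Real.arctan (t + A) + Real.arctan (t + B) = Real.pi / 2 + Real.arctan t :=
    arctan_add_arctan_eq_pi_div_two_add (by linarith) (by linear_combination -h)
  have e1 : 1 + (t + A) ^ 2 = A * (A + B + 2 * t) := by linear_combination -h
  have e2 : 1 + (t + B) ^ 2 = B * (A + B + 2 * t) := by linear_combination -h
  have e3 : 1 + t ^ 2 = A * B := by linear_combination -h
  have : (2 : ℝ) / (A * B * (A + B + 2 * t)) = (t + A) / (1 + (t + A) ^ 2)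
      + (t + B) / (1 + (t + B) ^ 2) - t / (1 + t ^ 2) := by
    rw [e1, e2, e3]
    field_simp
    linear_combination -2 * h
  rw [this]
  simp only [segmentFun]
  linear_combination -harc

lemma arctan_le_self {x : ℝ} (hx : 0 ≤ x) : Real.arctan x ≤ x := by
  simpa using Real.le_tan (Real.arctan_nonneg.2 hx) (Real.arctan_lt_pi_div_two x)

lemma div_one_add_sq_le_arctan {x : ℝ} (hx : 0 ≤ x) : x / (1 + x ^ 2) ≤ Real.arctan x := by
  have h1 : x / (1 + x ^ 2) = Real.sin (Real.arctan x) * Real.cos (Real.arctan x) := by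
    rw [Real.sin_arctan, Real.cos_arctan, div_mul_div_comm, mul_one,
      Real.mul_self_sqrt (by positivity)]
  have h2 : 0 ≤ Real.arctan x := Real.arctan_nonneg.2 hx
  have h3 := Real.sin_le h2
  have h4 := Real.cos_le_one (Real.arctan x)
  have h5 := (Real.cos_arctan_pos x).le
  rw [h1]
  nlinarith

lemma abs_segmentFun_le (t : ℝ) : |segmentFun t| ≤ Real.pi / 2 + 1 := by
  have h1 := Real.arctan_lt_pi_div_two t
  have h2 := Real.neg_pi_div_two_lt_arctan t
  have h3 : |t / (1 + t ^ 2)| ≤ 1 := by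
    rw [abs_div, abs_of_pos (by positivity : 0 < 1 + t ^ 2), div_le_one (by positivity)]
    nlinarith [sq_nonneg (|t| - 1), sq_abs t]
  rw [abs_le] at h3 ⊢
  constructor <;> simp only [segmentFun] <;> linarith

lemma abs_pi_div_two_sub_segmentFun_le {t : ℝ} (ht : 1 ≤ t) :
    |Real.pi / 2 - segmentFun t| ≤ 2 / √(1 + t ^ 2) ^ 3 := by
  have ht0 : 0 < t := by linarith
  have e : Real.pi / 2 - segmentFun t = Real.arctan t⁻¹ - t / (1 + t ^ 2) := by
    rw [Real.arctan_inv_of_pos ht0, segmentFun]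
    ring
  have h1 := arctan_le_self (inv_nonneg.2 ht0.le)
  have h2 := div_one_add_sq_le_arctan (inv_nonneg.2 ht0.le)
  have e2 : t⁻¹ / (1 + t⁻¹ ^ 2) = t / (1 + t ^ 2) := by
    field_simp
    ring
  rw [e2] at h2
  rw [e, abs_of_nonneg (by linarith)]
  have e3 : t⁻¹ - t / (1 + t ^ 2) = 1 / (t * (1 + t ^ 2)) := by
    field_simp
    ring
  have hs : √(1 + t ^ 2) ≤ 2 * t := Real.sqrt_le_iff.2 ⟨by linarith, by nlinarith⟩
  have hs2 : √(1 + t ^ 2) ^ 2 = 1 + t ^ 2 := Real.sq_sqrt (by positivity)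
  have hs0 : 0 < √(1 + t ^ 2) := Real.sqrt_pos.2 (by positivity)
  calc Real.arctan t⁻¹ - t / (1 + t ^ 2) ≤ 1 / (t * (1 + t ^ 2)) := by rw [← e3]; linarith
    _ ≤ 2 / √(1 + t ^ 2) ^ 3 := by
      rw [pow_succ √(1 + t ^ 2), hs2, div_le_div_iff₀ (by positivity) (by positivity)]
      nlinarith [sq_nonneg t]

/-- The jump `(π / 2) ε` cancels the limits of `segmentFun` at `± ∞` up to a cubic error, provided
that the sign `ε` is that of `t` whenever `|t|` is large. -/
lemma exists_abs_sign_sub_segmentFun_le (K : ℝ) : ∃ C, ∀ (ε : ℤ) (t : ℝ), |ε| ≤ 1 →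
    (0 ≤ ε → -K ≤ t) → (ε ≤ 0 → t ≤ K) →
    |Real.pi / 2 * ε - segmentFun t| ≤ C / √(1 + t ^ 2) ^ 3 := by
  set M := max K 1 with hM
  have hMK : K ≤ M := le_max_left _ _
  have hM1 : 1 ≤ M := le_max_right _ _
  set C := (Real.pi + 1) * √(1 + M ^ 2) ^ 3 with hC
  have hpi := Real.pi_pos
  have hC0 : 0 ≤ C := by positivity
  have main : ∀ (ε : ℤ) (t : ℝ), |ε| ≤ 1 → |t| ≤ M →
      |Real.pi / 2 * ε - segmentFun t| ≤ C / √(1 + t ^ 2) ^ 3 := by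
    intro ε t hε ht
    have h1 : |Real.pi / 2 * ε - segmentFun t| ≤ Real.pi + 1 := by
      have h2 := abs_segmentFun_le t
      have h3 : |(ε : ℝ)| ≤ 1 := by exact_mod_cast hε
      have h4 : |Real.pi / 2 * ε| ≤ Real.pi / 2 := by
        rw [abs_mul, abs_of_pos (by positivity : 0 < Real.pi / 2)]
        nlinarith
      linarith [abs_sub (Real.pi / 2 * ε) (segmentFun t)]
    refine h1.trans ?_
    have h5 : √(1 + t ^ 2) ≤ √(1 + M ^ 2) := Real.sqrt_le_sqrt (by
      have := sq_le_sq' (abs_le.1 ht).1 (abs_le.1 ht).2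
      linarith)
    have hs0 : 0 < √(1 + t ^ 2) := Real.sqrt_pos.2 (by positivity)
    rw [le_div_iff₀ (by positivity), hC]
    gcongr
  have pos : ∀ t : ℝ, -K ≤ t → |Real.pi / 2 - segmentFun t| ≤ (C + 2) / √(1 + t ^ 2) ^ 3 := by
    intro t ht
    rcases le_or_gt t M with h | h
    · have := main 1 t (by simp) (abs_le.2 ⟨by linarith, h⟩)
      simp only [Int.cast_one, mul_one] at this
      refine this.trans ?_
      gcongr
      linarith
    · refine (abs_pi_div_two_sub_segmentFun_le (hM1.trans h.le)).trans ?_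
      gcongr
      linarith
  refine ⟨C + 2, fun ε t hε hlo hhi => ?_⟩
  obtain ⟨h1, h2⟩ := abs_le.1 hε
  obtain rfl | rfl | rfl : ε = -1 ∨ ε = 0 ∨ ε = 1 := by omega
  · have := pos (-t) (by linarith [hhi (by norm_num)])
    rw [segmentFun_neg, neg_sq, ← abs_neg] at this
    convert this using 2
    push_cast
    ring
  · refine (main 0 t (by simp) (abs_le.2 ⟨?_, ?_⟩)).trans ?_
    · linarith [hlo le_rfl]
    · linarith [hhi le_rfl]
    · gcongr
      linarith
  · have := pos t (hlo (by norm_num))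
    simpa using this

open ComplexConjugate
/-! ### Pairs of lattice points with given determinant -/

lemma latticeDet_eq (u v : Fin 2 → ℤ) : latticeDet u v = u 0 * v 1 - u 1 * v 0 := by
  simp [latticeDet, Matrix.det_fin_two]
  ring

lemma latticePoint_add (z : ℂ) (u v : Fin 2 → ℤ) :
    latticePoint z (u + v) = latticePoint z u + latticePoint z v := by
  simp only [latticePoint, Pi.add_apply, Int.cast_add]
  ring

lemma latticePoint_neg (z : ℂ) (u : Fin 2 → ℤ) : latticePoint z (-u) = -latticePoint z u := by
  simp only [latticePoint, Pi.neg_apply, Int.cast_neg]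
  ring

lemma latticePoint_injective {z : ℂ} (hz : 0 < z.im) : Function.Injective (latticePoint z) := by
  intro u v h
  have him := congrArg Complex.im h
  simp only [latticePoint, Complex.add_im, Complex.mul_im, Complex.intCast_re,
    Complex.intCast_im, zero_mul, add_zero] at him
  have h0 : u 0 = v 0 := by exact_mod_cast mul_right_cancel₀ hz.ne' him
  have h1 : u 1 = v 1 := by
    simp only [latticePoint, h0, add_right_inj] at h
    exact_mod_cast h
  ext i
  fin_cases i
  · exact h0
  · exact h1

@[simp] lemma latticePoint_zero (z : ℂ) : latticePoint z 0 = 0 := by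
  simp [latticePoint]

/-- The ordered pairs of integer vectors with determinant `D`. -/
abbrev DetPair (D : ℤ) : Type := {p : (Fin 2 → ℤ) × (Fin 2 → ℤ) // latticeDet p.1 p.2 = D}

namespace DetPair

variable {D : ℤ}

lemma det_coord (p : DetPair D) : p.1.1 0 * p.1.2 1 - p.1.1 1 * p.1.2 0 = D := by
  rw [← latticeDet_eq, p.2]

/-- `(u, v) ↦ (u, u + v)`. -/
def addRight : DetPair D ≃ DetPair D where
  toFun p := ⟨(p.1.1, p.1.1 + p.1.2), by
    simp only [latticeDet_eq, Pi.add_apply]; linear_combination det_coord p⟩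
  invFun p := ⟨(p.1.1, p.1.2 - p.1.1), by
    simp only [latticeDet_eq, Pi.sub_apply]; linear_combination det_coord p⟩
  left_inv p := by ext <;> simp
  right_inv p := by ext <;> simp

/-- `(u, v) ↦ (u + v, v)`. -/
def addLeft : DetPair D ≃ DetPair D where
  toFun p := ⟨(p.1.1 + p.1.2, p.1.2), by
    simp only [latticeDet_eq, Pi.add_apply]; linear_combination det_coord p⟩
  invFun p := ⟨(p.1.1 - p.1.2, p.1.2), by
    simp only [latticeDet_eq, Pi.sub_apply]; linear_combination det_coord p⟩
  left_inv p := by ext <;> simp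
  right_inv p := by ext <;> simp

/-- `(u, v) ↦ (-v, u)`. -/
def quarterTurn : DetPair D ≃ DetPair D where
  toFun p := ⟨(-p.1.2, p.1.1), by
    simp only [latticeDet_eq, Pi.neg_apply]; linear_combination det_coord p⟩
  invFun p := ⟨(p.1.2, -p.1.1), by
    simp only [latticeDet_eq, Pi.neg_apply]; linear_combination det_coord p⟩
  left_inv p := by ext <;> simp
  right_inv p := by ext <;> simp

/-- `(u, v) ↦ (v, -(u + v))`, the cyclic rotation of the triples with sum zero. -/
def rotate : DetPair D ≃ DetPair D where
  toFun p := ⟨(p.1.2, -(p.1.1 + p.1.2)), by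
    simp only [latticeDet_eq, Pi.neg_apply, Pi.add_apply]; linear_combination det_coord p⟩
  invFun p := ⟨(-(p.1.1 + p.1.2), p.1.1), by
    simp only [latticeDet_eq, Pi.neg_apply, Pi.add_apply]; linear_combination det_coord p⟩
  left_inv p := by ext <;> simp
  right_inv p := by ext <;> simp

/-- `(u, v) ↦ (v, u)`. -/
def swap : DetPair D ≃ DetPair (-D) where
  toFun p := ⟨(p.1.2, p.1.1), by
    simp only [latticeDet_eq]; linear_combination -det_coord p⟩
  invFun p := ⟨(p.1.2, p.1.1), by
    simp only [latticeDet_eq]; linear_combination -det_coord p⟩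
  left_inv p := rfl
  right_inv p := rfl

lemma fst_ne_zero (hD : D ≠ 0) (p : DetPair D) : p.1.1 ≠ 0 := by
  intro h
  apply hD
  rw [← det_coord p, h]
  simp

lemma snd_ne_zero (hD : D ≠ 0) (p : DetPair D) : p.1.2 ≠ 0 := by
  intro h
  apply hD
  rw [← det_coord p, h]
  simp

/-- The real inner product of two lattice points divided by their oriented area: the cotangent
of the angle between them. -/
noncomputable def cotAngle (z : ℂ) (p : DetPair D) : ℝ :=
  (latticePoint z p.1.1 * conj (latticePoint z p.1.2)).re / (D * z.im)

/-- The reciprocal of `|u v (u + v)| ^ 2`. -/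
noncomputable def triangleTerm (z : ℂ) (p : DetPair D) : ℝ :=
  1 / ‖latticePoint z p.1.1 * latticePoint z p.1.2 *
    (latticePoint z p.1.1 + latticePoint z p.1.2)‖ ^ 2

variable {z : ℂ}

lemma normSq_mul_normSq (p : DetPair D) :
    Complex.normSq (latticePoint z p.1.1) * Complex.normSq (latticePoint z p.1.2) =
      (latticePoint z p.1.1 * conj (latticePoint z p.1.2)).re ^ 2 + (D * z.im) ^ 2 := by
  have h : (D : ℝ) = p.1.1 0 * p.1.2 1 - p.1.1 1 * p.1.2 0 := by exact_mod_cast (det_coord p).symm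
  simp only [h, latticePoint, Complex.normSq_apply, Complex.add_re, Complex.add_im,
    Complex.mul_re, Complex.mul_im, Complex.conj_re, Complex.conj_im, Complex.intCast_re,
    Complex.intCast_im]
  ring

lemma one_add_cotAngle_sq (hz : 0 < z.im) (hD : 0 < D) (p : DetPair D) :
    1 + cotAngle z p ^ 2 = (‖latticePoint z p.1.1‖ * ‖latticePoint z p.1.2‖ / (D * z.im)) ^ 2 := by
  have hD' : (0 : ℝ) < D := by exact_mod_cast hD
  have h := normSq_mul_normSq (z := z) p
  rw [Complex.normSq_eq_norm_sq, Complex.normSq_eq_norm_sq, ← mul_pow] at h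
  rw [cotAngle, div_pow _ _ 2, div_pow _ _ 2, h]
  field_simp
  ring

lemma cotAngle_addRight (p : DetPair D) :
    cotAngle z (addRight p) =
      cotAngle z p + Complex.normSq (latticePoint z p.1.1) / (D * z.im) := by
  simp only [cotAngle, addRight, Equiv.coe_fn_mk, latticePoint_add, map_add, mul_add,
    Complex.add_re, Complex.mul_conj, Complex.ofReal_re]
  ring

lemma cotAngle_addLeft (p : DetPair D) :
    cotAngle z (addLeft p) =
      cotAngle z p + Complex.normSq (latticePoint z p.1.2) / (D * z.im) := by
  simp only [cotAngle, addLeft, Equiv.coe_fn_mk, latticePoint_add, add_mul,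
    Complex.add_re, Complex.mul_conj, Complex.ofReal_re]
  ring

lemma cotAngle_quarterTurn (p : DetPair D) : cotAngle z (quarterTurn p) = -cotAngle z p := by
  simp only [cotAngle, quarterTurn, Equiv.coe_fn_mk, latticePoint_neg, Complex.mul_re,
    Complex.neg_re, Complex.neg_im, Complex.conj_re, Complex.conj_im]
  ring

lemma triangleTerm_eq (hz : 0 < z.im) (hD : 0 < D) (p : DetPair D) :
    2 * (D * z.im) ^ 3 * triangleTerm z p =
      segmentFun (cotAngle z (addRight p)) + segmentFun (cotAngle z (addLeft p)) -
        segmentFun (cotAngle z p) - Real.pi / 2 := by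
  have hD' : (0 : ℝ) < D := by exact_mod_cast hD
  have hY : 0 < D * z.im := mul_pos hD' hz
  have hu : 0 < Complex.normSq (latticePoint z p.1.1) := Complex.normSq_pos.2 fun h =>
    fst_ne_zero hD.ne' p (latticePoint_injective hz (by simpa using h))
  have hv : 0 < Complex.normSq (latticePoint z p.1.2) := Complex.normSq_pos.2 fun h =>
    snd_ne_zero hD.ne' p (latticePoint_injective hz (by simpa using h))
  have key := normSq_mul_normSq (z := z) p
  have hadd := Complex.normSq_add (latticePoint z p.1.1) (latticePoint z p.1.2)
  rw [cotAngle_addRight, cotAngle_addLeft, ← two_div_eq_segmentFun (div_pos hu hY) (div_pos hv hY),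
    triangleTerm, ← Complex.normSq_eq_norm_sq, map_mul, map_mul, hadd, cotAngle]
  · set A := Complex.normSq (latticePoint z p.1.1)
    set B := Complex.normSq (latticePoint z p.1.2)
    set Y := D * z.im
    field_simp
  · rw [cotAngle, div_mul_div_comm, key]
    field_simp

end DetPair

/-! ### The sign of the cotangent at the cusp and its defect -/

lemma hasSum_sign_add_one_sub_sign :
    HasSum (fun m : ℤ => ((Int.sign (m + 1) - Int.sign m : ℤ) : ℝ)) 2 := by
  have h := hasSum_sum_of_ne_finset_zero (L := .unconditional ℤ) (s := ({-1, 0} : Finset ℤ))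
    (f := fun m : ℤ => ((Int.sign (m + 1) - Int.sign m : ℤ) : ℝ)) (by
      intro m hm
      simp only [Finset.mem_insert, Finset.mem_singleton, not_or] at hm
      rcases lt_or_gt_of_ne hm.2 with h | h
      · rw [Int.sign_eq_neg_one_of_neg h, Int.sign_eq_neg_one_of_neg (by omega)]
        simp
      · rw [Int.sign_eq_one_of_pos h, Int.sign_eq_one_of_pos (by omega)]
        simp)
  convert h using 1
  norm_num

lemma hasSum_sign_add_sub_sign (k : ℕ) :
    HasSum (fun m : ℤ => ((Int.sign (m + k) - Int.sign m : ℤ) : ℝ)) (2 * k) := by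
  induction k with
  | zero => simp
  | succ k ih =>
    have h := ((Equiv.addRight (1 : ℤ)).hasSum_iff.2 ih).add hasSum_sign_add_one_sub_sign
    convert h using 1
    · ext m
      simp only [Function.comp_apply, Equiv.coe_addRight]
      push_cast
      rw [add_assoc m 1 (k : ℤ), add_comm (1 : ℤ) k]
      ring
    · push_cast
      ring

lemma HasSum.prod_of_fintype {ι κ : Type*} [Fintype ι] {f : ι × κ → ℝ} {a : ι → ℝ}
    (h : ∀ i, HasSum (fun k => f (i, k)) (a i)) : HasSum f (∑ i, a i) := by
  classical
  have key : ∀ i, HasSum (fun p : ι × κ => if p.1 = i then f p else 0) (a i) := by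
    intro i
    have hinj : Function.Injective (fun k : κ => (i, k)) := fun k l h => (Prod.ext_iff.1 h).2
    refine (hinj.hasSum_iff ?_).1 ?_
    · rintro ⟨j, k⟩ hjk
      rw [if_neg]
      rintro rfl
      exact hjk ⟨k, rfl⟩
    · simpa [Function.comp_def] using h i
  have := hasSum_sum (s := Finset.univ) fun i _ => key i
  simpa using this

/-- The sign of the leading term of a linear polynomial `m T + n` as `T → ∞`. -/
def lexSign (m n : ℤ) : ℤ := if m = 0 then Int.sign n else Int.sign m

/-- If three nonzero numbers have sum zero, the signs of their pairwise products add up to `-1`, so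
the left-hand side vanishes unless one of `a`, `c`, `a + c` does. -/
lemma lexSign_defect {a b c d : ℤ} (h : a * d - b * c ≠ 0) :
    lexSign (a * (a + c)) (b * (b + d)) + lexSign ((a + c) * c) ((b + d) * d) -
        lexSign (a * c) (b * d) - 1 =
      (if a = 0 then Int.sign (b * (b + d)) - Int.sign (b * d) else 0) +
      (if c = 0 then Int.sign (d * (d + -(b + d))) - Int.sign (d * -(b + d)) else 0) +
      (if -(a + c) = 0 then Int.sign (-(b + d) * (-(b + d) + -(d + -(b + d)))) -
        Int.sign (-(b + d) * -(d + -(b + d))) else 0) := by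
  rw [show d * (d + -(b + d)) = -(b * d) by ring, show d * -(b + d) = -((b + d) * d) by ring,
    show -(b + d) * (-(b + d) + -(d + -(b + d))) = (b + d) * d by ring,
    show -(b + d) * -(d + -(b + d)) = -(b * (b + d)) by ring, Int.sign_neg, Int.sign_neg,
    Int.sign_neg]
  unfold lexSign
  by_cases ha : a = 0
  · subst ha
    have hc : c ≠ 0 := by
      rintro rfl
      simp at h
    have hcc : Int.sign (c * c) = 1 := Int.sign_eq_one_of_pos (mul_self_pos.2 hc)
    simp only [zero_mul, zero_add, if_true, mul_self_eq_zero, hc, if_false, neg_eq_zero, hcc]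
    ring
  by_cases hc : c = 0
  · subst hc
    have haa : Int.sign (a * a) = 1 := Int.sign_eq_one_of_pos (mul_self_pos.2 ha)
    simp only [mul_zero, add_zero, if_true, mul_self_eq_zero, ha, if_false, neg_eq_zero, haa]
    ring
  by_cases hac : a + c = 0
  · obtain rfl : c = -a := by linarith
    have haa : Int.sign (a * -a) = -1 := Int.sign_eq_neg_one_of_neg (by
      linarith [mul_self_pos.2 ha])
    simp only [hac, mul_zero, zero_mul, if_true, mul_eq_zero, ha, neg_eq_zero, if_false, or_self,
      haa]
    ring
  · have h3 : ¬ -(a + c) = 0 := by omega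
    simp only [mul_eq_zero, ha, hc, hac, h3, or_self, if_false, Int.sign_mul]
    rcases lt_or_gt_of_ne ha with h1 | h1 <;> rcases lt_or_gt_of_ne hc with h2 | h2 <;>
    rcases lt_or_gt_of_ne hac with h4 | h4 <;>
    first
    | omega
    | (simp [Int.sign_eq_neg_one_of_neg, Int.sign_eq_one_of_pos, h1, h2, h4])

namespace DetPair

variable {D : ℤ} {z : ℂ}

/-- The sign of the inner product of `u` and `v` as `z → i ∞`: that of the product of the first
coordinates or, if this vanishes, that of the product of the second coordinates. -/
def cuspSign (p : DetPair D) : ℤ := lexSign (p.1.1 0 * p.1.2 0) (p.1.1 1 * p.1.2 1)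

lemma cuspSign_quarterTurn (p : DetPair D) : cuspSign (quarterTurn p) = -cuspSign p := by
  have h0 : (quarterTurn p).1.1 0 * (quarterTurn p).1.2 0 = -(p.1.1 0 * p.1.2 0) := by
    simp only [quarterTurn, Equiv.coe_fn_mk, Pi.neg_apply]
    ring
  have h1 : (quarterTurn p).1.1 1 * (quarterTurn p).1.2 1 = -(p.1.1 1 * p.1.2 1) := by
    simp only [quarterTurn, Equiv.coe_fn_mk, Pi.neg_apply]
    ring
  simp only [cuspSign, lexSign, h0, h1, neg_eq_zero, Int.sign_neg]
  split_ifs <;> rfl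

lemma abs_cuspSign_le (p : DetPair D) : |cuspSign p| ≤ 1 := by
  have key : ∀ n : ℤ, |Int.sign n| ≤ 1 := by
    intro n
    rcases lt_trichotomy n 0 with h | rfl | h
    · simp [Int.sign_eq_neg_one_of_neg h]
    · simp
    · simp [Int.sign_eq_one_of_pos h]
  unfold cuspSign lexSign
  split_ifs <;> exact key _

/-- The contribution to the defect of `cuspSign` of a pair whose first lattice point is real, that
is, has first coordinate zero. -/
def axisTerm (p : DetPair D) : ℤ :=
  if p.1.1 0 = 0 then Int.sign (p.1.1 1 * (p.1.1 1 + p.1.2 1)) - Int.sign (p.1.1 1 * p.1.2 1)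
  else 0

/-- The defect of `cuspSign` in the telescoping identity comes only from the triples one of whose
points is real. -/
lemma cuspSign_addRight_add_cuspSign_addLeft (hD : D ≠ 0) (p : DetPair D) :
    cuspSign (addRight p) + cuspSign (addLeft p) - cuspSign p - 1 =
      axisTerm p + axisTerm (rotate p) + axisTerm (rotate (rotate p)) := by
  apply lexSign_defect
  exact (det_coord p).trans_ne hD

/-- For fixed `u = (0, b)` with `b ∣ n`, the sum over `v` of `axisTerm` telescopes to `2 |b|`, and
each positive divisor occurs as `|b|` twice. -/
lemma hasSum_axisTerm {n : ℕ} (hn : n ≠ 0) :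
    HasSum (fun p : DetPair n => (axisTerm p : ℝ)) (4 * ArithmeticFunction.sigma 1 n) := by
  -- The pairs on which `axisTerm` is supported are `u = (0, ε k)`, `v = (-ε n / k, ε m)`.
  let g : (n.divisors × ℤˣ) × ℤ → DetPair n := fun x =>
    ⟨(![0, x.1.2 * (x.1.1 : ℕ)], ![-(x.1.2 * (n / (x.1.1 : ℕ) : ℕ)), x.1.2 * x.2]), by
      have h1 : ((x.1.2 : ℤ)) * x.1.2 = 1 := by
        rw [← Units.val_mul, Int.units_mul_self, Units.val_one]
      have h2 : ((n / (x.1.1 : ℕ) : ℕ) : ℤ) * (x.1.1 : ℕ) = n := by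
        exact_mod_cast Nat.div_mul_cancel (Nat.dvd_of_mem_divisors x.1.1.2)
      simp only [latticeDet_eq, Matrix.cons_val_zero, Matrix.cons_val_one]
      linear_combination ((n / (x.1.1 : ℕ) : ℕ) : ℤ) * (x.1.1 : ℕ) * h1 + h2⟩
  have hk : ∀ k : n.divisors, (k : ℕ) ≠ 0 := fun k => (Nat.pos_of_mem_divisors k.2).ne'
  have hg : Function.Injective g := by
    rintro ⟨⟨k, ε⟩, m⟩ ⟨⟨k', ε'⟩, m'⟩ h
    have e1 : (ε : ℤ) * (k : ℕ) = ε' * (k' : ℕ) := congrFun (congrArg (fun p => p.1.1) h) 1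
    have e2 : (ε : ℤ) * m = ε' * m' := congrFun (congrArg (fun p => p.1.2) h) 1
    have p1 : (0 : ℤ) < (k : ℕ) := by exact_mod_cast Nat.pos_of_ne_zero (hk k)
    have p2 : (0 : ℤ) < (k' : ℕ) := by exact_mod_cast Nat.pos_of_ne_zero (hk k')
    have hε : ε = ε' := by
      rcases Int.units_eq_one_or ε with rfl | rfl <;> rcases Int.units_eq_one_or ε' with rfl | rfl
      · rfl
      · simp at e1
        omega
      · simp at e1
        omega
      · rfl
    subst hε
    have hε0 : (ε : ℤ) ≠ 0 := ε.ne_zero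
    have e3 := mul_left_cancel₀ hε0 e1
    have e4 := mul_left_cancel₀ hε0 e2
    have e5 : k = k' := Subtype.ext (by exact_mod_cast e3)
    rw [e4, e5]
  refine (hg.hasSum_iff ?_).1 ?_
  · intro p hp
    have : ¬ p.1.1 0 = 0 := by
      intro h0
      apply hp
      have hdet := det_coord p
      rw [h0, zero_mul, zero_sub] at hdet
      have hb : p.1.1 1 ≠ 0 := by
        intro h
        rw [h] at hdet
        simp at hdet
        omega
      have hnat : (p.1.1 1).natAbs * (p.1.2 0).natAbs = n := by
        rw [← Int.natAbs_mul, ← Int.natAbs_neg, hdet, Int.natAbs_natCast]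
      have hdiv : n / (p.1.1 1).natAbs = (p.1.2 0).natAbs :=
        Nat.div_eq_of_eq_mul_right (Int.natAbs_pos.2 hb) hnat.symm
      have hmem : (p.1.1 1).natAbs ∈ n.divisors :=
        Nat.mem_divisors.2 ⟨Dvd.intro _ hnat, hn⟩
      obtain ⟨ε, hε⟩ : ∃ ε : ℤˣ, p.1.1 1 = ε * (p.1.1 1).natAbs := by
        rcases Int.natAbs_eq (p.1.1 1) with h | h
        · exact ⟨1, by simpa using h⟩
        · exact ⟨-1, by simpa using h⟩
      have h1 : (ε : ℤ) * ε = 1 := by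
        rw [← Units.val_mul, Int.units_mul_self, Units.val_one]
      have hc : p.1.2 0 = -(ε * (p.1.2 0).natAbs) := by
        apply mul_left_cancel₀ hb
        have hcast : ((p.1.1 1).natAbs : ℤ) * (p.1.2 0).natAbs = n := by exact_mod_cast hnat
        linear_combination -hdet + (ε : ℤ) * (p.1.2 0).natAbs * hε +
          ((p.1.1 1).natAbs : ℤ) * (p.1.2 0).natAbs * h1 + hcast
      refine ⟨((⟨_, hmem⟩, ε), ε * p.1.2 1), ?_⟩
      ext i
      · fin_cases i
        · exact h0.symm
        · exact hε.symm
      · fin_cases i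
        · simpa [g, hdiv] using hc.symm
        · simp [g, ← mul_assoc, h1]
    simp [axisTerm, this]
  · have hsum : ∑ i : n.divisors × ℤˣ, (2 * ((i.1 : ℕ) : ℝ)) =
        4 * ArithmeticFunction.sigma 1 n := by
      rw [Fintype.sum_prod_type, ArithmeticFunction.sigma_one_apply]
      simp only [Finset.sum_const, Finset.card_univ, Fintype.card_units_int, nsmul_eq_mul]
      rw [Finset.sum_coe_sort n.divisors (fun k : ℕ => ((2 : ℕ) : ℝ) * (2 * (k : ℝ)))]
      push_cast
      rw [Finset.mul_sum]
      exact Finset.sum_congr rfl fun x _ => by ring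
    rw [← hsum]
    refine HasSum.prod_of_fintype fun i => ?_
    convert hasSum_sign_add_sub_sign (i.1 : ℕ) using 1
    ext m
    have h1 : (i.2 : ℤ) * i.2 = 1 := by
      rw [← Units.val_mul, Int.units_mul_self, Units.val_one]
    have hpos : (0 : ℤ) < (i.1 : ℕ) := by exact_mod_cast Nat.pos_of_ne_zero (hk i.1)
    have e1 : (i.2 : ℤ) * (i.1 : ℕ) * (i.2 * (i.1 : ℕ) + i.2 * m) = (i.1 : ℕ) * (m + (i.1 : ℕ)) := by
      linear_combination ((i.1 : ℕ) : ℤ) * (m + (i.1 : ℕ)) * h1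
    have e2 : (i.2 : ℤ) * (i.1 : ℕ) * (i.2 * m) = (i.1 : ℕ) * m := by
      linear_combination ((i.1 : ℕ) : ℤ) * m * h1
    simp only [g, Function.comp_apply, axisTerm, Matrix.cons_val_zero, Matrix.cons_val_one,
      if_true, e1, e2]
    simp only [Int.sign_mul, Int.sign_eq_one_of_pos hpos, one_mul]

end DetPair

/-! ### The sum over pairs of given determinant -/

namespace DetPair

variable {D : ℤ} {z : ℂ}

/-- The sign at the cusp is the sign of the cotangent, as far as the latter is large. -/
lemma exists_neg_le_cotAngle (hz : 0 < z.im) (hD : 0 < D) :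
    ∃ K, ∀ p : DetPair D, 0 ≤ cuspSign p → -K ≤ cotAngle z p := by
  have hD' : (0 : ℝ) < D := by exact_mod_cast hD
  have hY : 0 < D * z.im := mul_pos hD' hz
  refine ⟨((D : ℝ) ^ 2 + D * |z.re|) / (D * z.im), fun p hp => ?_⟩
  rw [cotAngle, ← neg_div]
  refine div_le_div_of_nonneg_right ?_ hY.le
  have hdet : (p.1.1 0 * p.1.2 1 - p.1.1 1 * p.1.2 0 : ℝ) = D := by exact_mod_cast det_coord p
  have hre : (latticePoint z p.1.1 * conj (latticePoint z p.1.2)).re =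
      p.1.1 0 * p.1.2 0 * z.im ^ 2 + (p.1.1 0 * p.1.2 0 * z.re ^ 2 +
        (p.1.1 0 * p.1.2 1 + p.1.1 1 * p.1.2 0) * z.re + p.1.1 1 * p.1.2 1) := by
    simp only [latticePoint, Complex.mul_re, Complex.add_re, Complex.add_im,
      Complex.mul_im, Complex.conj_re, Complex.conj_im, Complex.intCast_re, Complex.intCast_im]
    ring
  have hx := mul_nonneg hD'.le (abs_nonneg z.re)
  have hx1 : -(D * |z.re|) ≤ D * z.re := by nlinarith [neg_abs_le z.re]
  have hx2 : D * z.re ≤ D * |z.re| := by nlinarith [le_abs_self z.re]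
  rw [hre]
  unfold cuspSign lexSign at hp
  split_ifs at hp with h0
  · have hbd : (0 : ℝ) ≤ p.1.1 1 * p.1.2 1 := by exact_mod_cast Int.sign_nonneg_iff.1 hp
    have h0' : (p.1.1 0 * p.1.2 0 : ℝ) = 0 := by exact_mod_cast h0
    rw [h0']
    rcases mul_eq_zero.1 h0' with h | h
    · rw [h] at hdet ⊢
      nlinarith [sq_nonneg (D : ℝ)]
    · rw [h] at hdet ⊢
      nlinarith [sq_nonneg (D : ℝ)]
  · have hac : 0 < p.1.1 0 * p.1.2 0 := lt_of_le_of_ne (Int.sign_nonneg_iff.1 hp) (Ne.symm h0)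
    have hac1 : (1 : ℝ) ≤ p.1.1 0 * p.1.2 0 := by exact_mod_cast hac
    generalize (p.1.1 0 : ℝ) = a at *
    generalize (p.1.1 1 : ℝ) = b at *
    generalize (p.1.2 0 : ℝ) = c at *
    generalize (p.1.2 1 : ℝ) = d at *
    set N := a * c * z.re ^ 2 + (a * d + b * c) * z.re + b * d with hN
    -- Completing the square: the quadratic polynomial `N` in `z.re` has discriminant `D ^ 2`.
    have hsq : 4 * (a * c) * N = (2 * (a * c) * z.re + (a * d + b * c)) ^ 2 - (D : ℝ) ^ 2 := by
      rw [hN, ← hdet]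
      ring
    have hN' : -(D : ℝ) ^ 2 ≤ N := by
      by_contra! hlt
      nlinarith [sq_nonneg (2 * (a * c) * z.re + (a * d + b * c)), sq_nonneg (D : ℝ)]
    nlinarith [mul_nonneg (zero_le_one.trans hac1) (sq_nonneg z.im)]

lemma exists_cotAngle_bounds (hz : 0 < z.im) (hD : 0 < D) :
    ∃ K, ∀ p : DetPair D,
      (0 ≤ cuspSign p → -K ≤ cotAngle z p) ∧ (cuspSign p ≤ 0 → cotAngle z p ≤ K) := by
  obtain ⟨K, hK⟩ := exists_neg_le_cotAngle hz hD
  refine ⟨K, fun p => ⟨hK p, fun h => ?_⟩⟩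
  have := hK (quarterTurn p) (by rw [cuspSign_quarterTurn]; omega)
  rw [cotAngle_quarterTurn] at this
  linarith

/-- The function `segmentFun` of the cotangent, made summable by a jump at infinity. -/
noncomputable def segmentTerm (z : ℂ) (p : DetPair D) : ℝ :=
  Real.pi / 2 * cuspSign p - segmentFun (cotAngle z p)

lemma exists_norm_latticePoint_ge (hz : 0 < z.im) :
    ∃ r, 0 < r ∧ ∀ u : Fin 2 → ℤ, u ≠ 0 → r * ‖u‖ ≤ ‖latticePoint z u‖ :=
  ⟨EisensteinSeries.r ⟨z, hz⟩, EisensteinSeries.r_pos _, fun _ hu =>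
    EisensteinSeries.r_mul_max_le ⟨z, hz⟩ hu⟩

lemma summable_segmentTerm (hz : 0 < z.im) (hD : 0 < D) :
    Summable fun p : DetPair D => segmentTerm z p := by
  have hD' : (0 : ℝ) < D := by exact_mod_cast hD
  have hY : 0 < D * z.im := mul_pos hD' hz
  obtain ⟨K, hK⟩ := exists_cotAngle_bounds hz hD
  obtain ⟨C, hC⟩ := exists_abs_sign_sub_segmentFun_le K
  obtain ⟨r, hr, hru⟩ := exists_norm_latticePoint_ge hz
  have hs : Summable fun u : Fin 2 → ℤ => 1 / ‖u‖ ^ 3 := by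
    refine (EisensteinSeries.summable_one_div_norm_rpow (k := 3) (by norm_num)).congr fun u => ?_
    rw [Real.rpow_neg (norm_nonneg _), one_div]
    norm_cast
  have hs2 : Summable fun p : DetPair D => 1 / ‖p.1.1‖ ^ 3 * (1 / ‖p.1.2‖ ^ 3) :=
    (hs.mul_of_nonneg hs (fun u => by positivity) (fun u => by positivity)).comp_injective
      Subtype.val_injective
  refine Summable.of_norm_bounded (hs2.mul_left (|C| * (D * z.im / r ^ 2) ^ 3)) fun p => ?_
  have hu := fst_ne_zero hD.ne' p
  have hv := snd_ne_zero hD.ne' p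
  have hu0 : 0 < ‖p.1.1‖ := norm_pos_iff.2 hu
  have hv0 : 0 < ‖p.1.2‖ := norm_pos_iff.2 hv
  have hsqrt : √(1 + cotAngle z p ^ 2) =
      ‖latticePoint z p.1.1‖ * ‖latticePoint z p.1.2‖ / (D * z.im) := by
    rw [one_add_cotAngle_sq hz hD, Real.sqrt_sq (by positivity)]
  have hlow : r * ‖p.1.1‖ * (r * ‖p.1.2‖) / (D * z.im) ≤ √(1 + cotAngle z p ^ 2) := by
    rw [hsqrt]
    have h1 := hru _ hu
    have h2 := hru _ hv
    gcongr
  calc ‖segmentTerm z p‖ ≤ C / √(1 + cotAngle z p ^ 2) ^ 3 :=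
        hC _ _ (abs_cuspSign_le p) (hK p).1 (hK p).2
    _ ≤ |C| / √(1 + cotAngle z p ^ 2) ^ 3 := by
        gcongr
        exact le_abs_self C
    _ ≤ |C| / (r * ‖p.1.1‖ * (r * ‖p.1.2‖) / (D * z.im)) ^ 3 := by gcongr
    _ = |C| * (D * z.im / r ^ 2) ^ 3 * (1 / ‖p.1.1‖ ^ 3 * (1 / ‖p.1.2‖ ^ 3)) := by
        field_simp

lemma hasSum_segmentTerm (hz : 0 < z.im) (hD : 0 < D) :
    HasSum (fun p : DetPair D => segmentTerm z p) 0 := by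
  have h := (summable_segmentTerm hz hD).hasSum
  have h2 := quarterTurn.hasSum_iff.2 h
  have h3 : (fun p : DetPair D => segmentTerm z p) ∘ quarterTurn = fun p => -segmentTerm z p := by
    ext p
    simp only [Function.comp_apply, segmentTerm, cuspSign_quarterTurn, cotAngle_quarterTurn,
      segmentFun_neg]
    push_cast
    ring
  rw [h3] at h2
  have h4 := h2.unique h.neg
  have h5 : ∑' p : DetPair D, segmentTerm z p = 0 := by linarith
  rwa [h5] at h

/-- The sum over the pairs of determinant `n`: the terms `segmentTerm` telescope to zero, and the
defect of the signs at the cusp remains. -/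
lemma hasSum_triangleTerm (hz : 0 < z.im) {n : ℕ} (hn : n ≠ 0) :
    HasSum (fun p : DetPair n => triangleTerm z p)
      (3 * Real.pi / z.im ^ 3 * (ArithmeticFunction.sigma 1 n / (n : ℝ) ^ 3)) := by
  have hD : (0 : ℤ) < n := by exact_mod_cast Nat.pos_of_ne_zero hn
  have hn' : (n : ℝ) ≠ 0 := by exact_mod_cast hn
  have h := hasSum_segmentTerm hz hD
  have hL := addLeft.hasSum_iff.2 h
  have hR := addRight.hasSum_iff.2 h
  have hA := hasSum_axisTerm hn
  have hA1 := rotate.hasSum_iff.2 hA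
  have hA2 := rotate.hasSum_iff.2 hA1
  have hsum := (((h.sub hL).sub hR).add (((hA.add hA1).add hA2).mul_left (Real.pi / 2))).mul_left
    (1 / (2 * ((n : ℤ) * z.im) ^ 3))
  have hval : 3 * Real.pi / z.im ^ 3 * (ArithmeticFunction.sigma 1 n / (n : ℝ) ^ 3) =
      1 / (2 * (((n : ℤ) : ℝ) * z.im) ^ 3) * (0 - 0 - 0 + Real.pi / 2 *
        (4 * ArithmeticFunction.sigma 1 n + 4 * ArithmeticFunction.sigma 1 n +
          4 * ArithmeticFunction.sigma 1 n)) := by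
    push_cast
    field_simp
    ring
  rw [hval]
  refine hsum.congr_fun fun p => ?_
  have h1 := triangleTerm_eq hz hD p
  have h2 : (cuspSign (addRight p) + cuspSign (addLeft p) - cuspSign p - 1 : ℝ) =
      axisTerm p + axisTerm (rotate p) + axisTerm (rotate (rotate p)) := by
    exact_mod_cast cuspSign_addRight_add_cuspSign_addLeft hD.ne' p
  have h3 : (2 * (((n : ℤ) : ℝ) * z.im) ^ 3) ≠ 0 := by
    push_cast
    positivity
  rw [one_div, eq_inv_mul_iff_mul_eq₀ h3, h1]
  simp only [Function.comp_apply, segmentTerm, ← h2]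
  ring

lemma hasSum_triangleTerm_neg (hz : 0 < z.im) {n : ℕ} (hn : n ≠ 0) :
    HasSum (fun p : DetPair (-n) => triangleTerm z p)
      (3 * Real.pi / z.im ^ 3 * (ArithmeticFunction.sigma 1 n / (n : ℝ) ^ 3)) := by
  rw [← swap.hasSum_iff]
  convert hasSum_triangleTerm hz hn using 1
  ext p
  simp only [Function.comp_apply, triangleTerm, swap, Equiv.coe_fn_mk]
  congr 3
  ring

end DetPair

open Complex
/-! ### The sum over all triples -/

lemma hasSum_sigma_div_cpow {s : ℂ} (hs : -1 < s.re) :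
    HasSum (fun n : ℕ => (n : ℂ) ^ (-s) * (ArithmeticFunction.sigma 1 n / (n : ℂ) ^ 3))
      (riemannZeta (s + 3) * riemannZeta (s + 2)) := by
  have h1 : LSeriesHasSum (fun n => ((ArithmeticFunction.zeta : ArithmeticFunction ℂ) n)) (s + 3)
      (riemannZeta (s + 3)) := by
    simpa using ArithmeticFunction.LSeriesHasSum_zeta (s := s + 3)
      (by simp only [add_re, re_ofNat]; linarith)
  have h2 : LSeriesHasSum
      (fun n => ((ArithmeticFunction.pow 1 : ArithmeticFunction ℕ) : ArithmeticFunction ℂ) n)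
      (s + 3) (riemannZeta (s + 2)) := by
    have h := ArithmeticFunction.LSeriesHasSum_zeta (s := s + 2)
      (by simp only [add_re, re_ofNat]; linarith)
    refine h.congr_fun fun n => ?_
    rcases eq_or_ne n 0 with rfl | hn
    · simp
    · have hn' : (n : ℂ) ≠ 0 := by exact_mod_cast hn
      rw [LSeries.term_of_ne_zero hn, LSeries.term_of_ne_zero hn,
        show s + 3 = (s + 2) + 1 by ring, cpow_add _ _ hn', cpow_one]
      simp [ArithmeticFunction.pow_apply, hn]
      field_simp
  have h := ArithmeticFunction.LSeriesHasSum_mul h1 h2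
  rw [← ArithmeticFunction.natCoe_mul, ArithmeticFunction.zeta_mul_pow_eq_sigma] at h
  refine h.congr_fun fun n => Eq.symm ?_
  rcases eq_or_ne n 0 with rfl | hn
  · simp
  · have hn' : (n : ℂ) ≠ 0 := by exact_mod_cast hn
    rw [LSeries.term_of_ne_zero hn, cpow_add _ _ hn', cpow_neg, ArithmeticFunction.natCoe_apply]
    norm_cast
    rw [div_mul_eq_div_div_swap]
    ring

/-- Admissible triples are determined by their first two members. -/
def admissibleTripleEquiv {z : ℂ} (hz : 0 < z.im) {D : ℤ} (hD : D ≠ 0) :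
    DetPair D ≃ {t : AdmissibleTriple z // latticeDet (t.1 0) (t.1 1) = D} where
  toFun p := ⟨⟨![p.1.1, p.1.2, -(p.1.1 + p.1.2)], by
    have h : ∀ u : Fin 2 → ℤ, u ≠ 0 → latticePoint z u ≠ 0 := fun u hu h0 =>
      hu (latticePoint_injective hz (by simpa using h0))
    refine ⟨?_, ?_, ?_⟩
    · simp [latticePoint_neg, latticePoint_add]
    · intro k
      fin_cases k
      · exact h _ (p.fst_ne_zero hD)
      · exact h _ (p.snd_ne_zero hD)
      · exact h _ ((DetPair.rotate p).snd_ne_zero hD)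
    · exact p.2.trans_ne hD⟩, p.2⟩
  invFun t := ⟨(t.1.1 0, t.1.1 1), t.2⟩
  left_inv p := rfl
  right_inv t := by
    obtain ⟨⟨v, hv⟩, ht⟩ := t
    refine Subtype.ext (Subtype.ext ?_)
    have h2 : v 2 = -(v 0 + v 1) := latticePoint_injective hz (by
      rw [latticePoint_neg, latticePoint_add]
      linear_combination hv.1)
    ext k i
    fin_cases k
    · rfl
    · rfl
    · exact (congrFun h2 i).symm

lemma tripleTerm_admissibleTripleEquiv {z : ℂ} (hz : 0 < z.im) {D : ℤ} (hD : D ≠ 0) (s : ℂ)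
    (p : DetPair D) :
    tripleTerm z s (admissibleTripleEquiv hz hD p).1 =
      (D.natAbs : ℂ) ^ (-s) * (p.triangleTerm z : ℝ) := by
  have h : latticeDet p.1.1 p.1.2 = D := p.2
  change ((|latticeDet p.1.1 p.1.2| : ℤ) : ℂ) ^ (-s) / ((‖latticePoint z p.1.1 *
    latticePoint z p.1.2 * latticePoint z (-(p.1.1 + p.1.2))‖ : ℝ) : ℂ) ^ 2 = _
  rw [h, latticePoint_neg, latticePoint_add, mul_neg, norm_neg, Int.abs_eq_natAbs,
    DetPair.triangleTerm]
  push_cast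
  rw [div_eq_mul_one_div, Nat.cast_natAbs]

/-- The sum over the triples of determinant `D`, for nonzero `D`. -/
lemma hasSum_tripleTerm_fiber_of_ne_zero {z : ℂ} (hz : 0 < z.im) (s : ℂ) {D : ℤ} (hD : D ≠ 0) :
    HasSum (fun t : {t : AdmissibleTriple z // latticeDet (t.1 0) (t.1 1) = D} =>
      tripleTerm z s t.1) (3 * Real.pi / (z.im : ℂ) ^ 3 * ((D.natAbs : ℂ) ^ (-s) *
        (ArithmeticFunction.sigma 1 D.natAbs / (D.natAbs : ℂ) ^ 3))) := by
  rw [← (admissibleTripleEquiv hz hD).hasSum_iff]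
  have key : HasSum (fun p : DetPair D => p.triangleTerm z)
      (3 * Real.pi / z.im ^ 3 *
        (ArithmeticFunction.sigma 1 D.natAbs / (D.natAbs : ℝ) ^ 3)) := by
    have h0 : D.natAbs ≠ 0 := Int.natAbs_ne_zero.2 hD
    generalize hn : D.natAbs = n at *
    obtain rfl | rfl := Int.natAbs_eq_iff.1 hn
    · exact DetPair.hasSum_triangleTerm hz h0
    · exact DetPair.hasSum_triangleTerm_neg hz h0
  have h := (hasSum_ofReal.2 key).mul_left ((D.natAbs : ℂ) ^ (-s))
  have hval : (D.natAbs : ℂ) ^ (-s) * ((3 * Real.pi / z.im ^ 3 *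
      (ArithmeticFunction.sigma 1 D.natAbs / (D.natAbs : ℝ) ^ 3) : ℝ) : ℂ) =
      3 * Real.pi / (z.im : ℂ) ^ 3 * ((D.natAbs : ℂ) ^ (-s) *
        (ArithmeticFunction.sigma 1 D.natAbs / (D.natAbs : ℂ) ^ 3)) := by
    push_cast
    ring
  rw [hval] at h
  exact h.congr_fun fun p => tripleTerm_admissibleTripleEquiv hz hD s p

/-- The sums over the fibers of the determinant add up to the right-hand side. The fiber over `0`
is empty, and `σ₁ 0 = 0`. -/
lemma hasSum_fiberSum {z s : ℂ} (hs : -1 < s.re) :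
    HasSum (fun D : ℤ => 3 * Real.pi / (z.im : ℂ) ^ 3 * ((D.natAbs : ℂ) ^ (-s) *
        (ArithmeticFunction.sigma 1 D.natAbs / (D.natAbs : ℂ) ^ 3)))
      (6 * (Real.pi : ℂ) / (z.im : ℂ) ^ 3 * riemannZeta (s + 3) * riemannZeta (s + 2)) := by
  have h := (hasSum_sigma_div_cpow hs).mul_left (3 * Real.pi / (z.im : ℂ) ^ 3)
  have h2 := HasSum.of_nat_of_neg (f := fun D : ℤ => 3 * Real.pi / (z.im : ℂ) ^ 3 *
    ((D.natAbs : ℂ) ^ (-s) * (ArithmeticFunction.sigma 1 D.natAbs / (D.natAbs : ℂ) ^ 3)))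
    (by simpa using h) (by simpa using h)
  have hval : ∀ a b c : ℂ, 6 * (Real.pi : ℂ) / a * b * c =
      3 * Real.pi / a * (b * c) + 3 * Real.pi / a * (b * c) := fun a b c => by ring
  rw [hval]
  simpa using h2

lemma hasSum_tripleTerm_fiber {z : ℂ} (hz : 0 < z.im) (s : ℂ) (D : ℤ) :
    HasSum (fun t : {t : AdmissibleTriple z // latticeDet (t.1 0) (t.1 1) = D} =>
      tripleTerm z s t.1) (3 * Real.pi / (z.im : ℂ) ^ 3 * ((D.natAbs : ℂ) ^ (-s) *
        (ArithmeticFunction.sigma 1 D.natAbs / (D.natAbs : ℂ) ^ 3))) := by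
  rcases eq_or_ne D 0 with rfl | hD
  · have : IsEmpty {t : AdmissibleTriple z // latticeDet (t.1 0) (t.1 1) = 0} :=
      ⟨fun t => t.1.2.2.2 t.2⟩
    simp [hasSum_empty]
  · exact hasSum_tripleTerm_fiber_of_ne_zero hz s hD

lemma norm_tripleTerm {z : ℂ} (s : ℂ) (t : AdmissibleTriple z) :
    (‖tripleTerm z s t‖ : ℂ) = tripleTerm z s.re t := by
  have h : 0 < |latticeDet (t.1 0) (t.1 1)| := abs_pos.2 t.2.2.2
  have h' : (0 : ℝ) < (|latticeDet (t.1 0) (t.1 1)| : ℤ) := by exact_mod_cast h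
  simp only [tripleTerm]
  rw [norm_div, norm_pow, norm_real, norm_norm, ← ofReal_intCast, norm_cpow_eq_rpow_re_of_pos h',
    ofReal_div, ofReal_cpow h'.le]
  simp

lemma summable_tripleTerm {z : ℂ} (hz : 0 < z.im) {s : ℂ} (hs : -1 < s.re) :
    Summable fun t : AdmissibleTriple z => tripleTerm z s t := by
  refine Summable.of_norm ?_
  rw [← (Equiv.sigmaFiberEquiv fun t : AdmissibleTriple z =>
    latticeDet (t.1 0) (t.1 1)).summable_iff]
  have hfib : ∀ D : ℤ, HasSum (fun t : {t : AdmissibleTriple z //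
      latticeDet (t.1 0) (t.1 1) = D} => (‖tripleTerm z s t.1‖ : ℂ)) _ := fun D => by
    simpa only [norm_tripleTerm] using hasSum_tripleTerm_fiber hz s.re D
  refine (summable_sigma_of_nonneg fun x => norm_nonneg _).2 ⟨fun D => ?_, ?_⟩
  · exact summable_ofReal.1 (hfib D).summable
  · rw [← summable_ofReal]
    refine (hasSum_fiberSum (z := z) (s := s.re) (by simpa using hs)).summable.congr fun D => ?_
    rw [ofReal_tsum]
    exact (hfib D).tsum_eq.symm

theorem theorem4 (z : ℂ) (hz : 0 < z.im) (s : ℂ) (hs : -1 < s.re) :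
    HasSum (fun t : AdmissibleTriple z => tripleTerm z s t)
      (6 * (Real.pi : ℂ) / (z.im : ℂ) ^ 3 * riemannZeta (s + 3) * riemannZeta (s + 2)) := by
  rw [← (Equiv.sigmaFiberEquiv fun t : AdmissibleTriple z =>
    latticeDet (t.1 0) (t.1 1)).hasSum_iff]
  exact (hasSum_fiberSum hs).sigma_of_hasSum (hasSum_tripleTerm_fiber hz s)
    ((Equiv.summable_iff _).2 (summable_tripleTerm hz hs))
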